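/- Conventions. Let $L$ be a poset with bottom element $0$. A filter of $L$ is a nonempty down-directed upper subset. Write $s\gg r$ ($s$ is way-above $r$) if every filter $F$ of $L$ that has an infimum $\bigwedge F\leqslant r$ contains $s$. $L$ is a domain if every filter of $L$ has an infimum and if, for every $r\in L$, the set $\{s\in L: s\gg r\}$ is a filter with infimum $r$. Let $E$ be a topological space that is quasisober (every irreducible closed subset is the closure of a point; $E$ need not be $T_0$). The saturation $\uparrow\! A$ of $A\subset E$ is the intersection of all open sets containing $A$, and $A$ is saturated if $A=\uparrow\! A$. Let $\mathscr G$ be the collection of open subsets, $\mathscr Q$ the collection of compact saturated subsets, $\mathscr B$ the $\sigma$-algebra generated by $\mathscr G\cup\mathscr Q$ (its elements are the Borel sets), and $\mathscr K$ the collection of compact Borel subsets. (As $E$ is quasisober, $\mathscr Q$ is closed under filtered intersections.) "Locally compact" means that every point has a neighbourhood base of compact sets. A map $\nu:\mathscr B\to L$ with $\nu(\emptyset)=0$ is a maxitive (resp. $\sigma$-maxitive, completely maxitive) measure if, for every finite (resp. countable, arbitrary) family $(B_j)_j$ in $\mathscr B$ with $\bigcup_j B_j\in\mathscr B$, the supremum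 $\bigoplus_j\nu(B_j)$ exists and equals $\nu(\bigcup_j B_j)$. For such a $\nu$ put $\nu^+(A)=\bigwedge\{\nu(G):G\in\mathscr G,\ G\supset A\}$ for $A \in \mathscr B$. A maxitive measure $\nu$ is * inner-continuous if $\nu(B)=\bigoplus\{\nu(\uparrow\! K):K\in\mathscr K,\ K\subset B\}$ for all $B\in\mathscr B$; outer-continuous if $\nu(B)=\nu^+(B)$ for all $B\in\mathscr B$; regular if it is both; * weakly inner-continuous if $\nu(G)=\bigoplus\{\nu^+(K):K\in\mathscr K,\ K\subset G\}$ for all $G\in\mathscr G$; weakly outer-continuous if $\nu(K)=\nu^+(K)$ for all $K\in\mathscr K$; * $\mathscr Q$-smooth if $\nu(\bigcap_j Q_j)=\bigwedge_j\nu(Q_j)$ for every nonempty filtered family $(Q_j)_j$ in $\mathscr Q$; * saturated if $\nu(K)=\nu(\uparrow\! K)$ for all $K\in\mathscr K$. A cardinal density of $\nu$ is a map $c:E\to L$ with $\nu(B)=\bigoplus_{x\in B}c(x)$ for all $B\in\mathscr B$; it is usc (upper-semicontinuous) if $\{x\in E:t\gg c(x)\}$ is open for every $t\in L$. Theorem.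 Let $L$ be a domain with a bottom element, $E$ a quasisober space, and $\nu$ an $L$-valued maxitive measure on $\mathscr B$. Then $\nu$ has a cardinal density if and only if $\nu$ is completely maxitive. Also, consider the following assertions: 1. $\nu$ is regular; 2. $\nu$ has a usc cardinal density; 3. $\nu$ is outer-continuous and completely maxitive; 4. $\nu$ is weakly outer-continuous and weakly inner-continuous; 5. $\nu$ is weakly outer-continuous and $\sigma$-maxitive; 6. $\nu$ is weakly outer-continuous; 7. $\nu$ is $\mathscr Q$-smooth and saturated; 8. $\nu$ is $\mathscr Q$-smooth, weakly inner-continuous, and saturated; 9. $\nu$ is $\mathscr Q$-smooth, $\sigma$-maxitive, and saturated. Then (1) $\Leftrightarrow$ (2) $\Leftrightarrow$ (3) $\Leftrightarrow$ (4) $\Rightarrow$ (5) $\Rightarrow$ (6) $\Rightarrow$ (7) $\Leftarrow$ (8). Moreover, * if $E$ is second-countable, then (1) $\Leftrightarrow$ (2) $\Leftrightarrow$ (3) $\Leftrightarrow$ (4) $\Leftrightarrow$ (5); * if $E$ is locally compact, then (8) $\Leftrightarrow$ (1) $\Leftrightarrow$ (2) $\Leftrightarrow$ (3) $\Leftrightarrow$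 (4), and (6) $\Leftrightarrow$ (7); * if $E$ is $\sigma$-compact and metrizable, then (9) $\Leftrightarrow$ (1) $\Leftrightarrow$ (2) $\Leftrightarrow$ (3) $\Leftrightarrow$ (4) $\Leftrightarrow$ (5); * if $E$ is locally compact Polish, then (8) $\Leftrightarrow$ (9) $\Leftrightarrow$ (1) $\Leftrightarrow$ (2) $\Leftrightarrow$ (3) $\Leftrightarrow$ (4) $\Leftrightarrow$ (5), and (6) $\Leftrightarrow$ (7). -/

import Mathlib

/-! ### Domains (in the order-dual sense: filters, infima, way-above) -/

section Domain

/-- `WayAbove s r` (written `s ≫ r`): for every filter `F` of `L` that has an infimum `m`,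
if `m ≤ r` then `s ∈ F`. (An `Order.IsPFilter` is a nonempty, down-directed upper set.) -/
def WayAbove {L : Type*} [PartialOrder L] (s r : L) : Prop :=
  ∀ (F : Set L) (m : L), Order.IsPFilter F → IsGLB F m → m ≤ r → s ∈ F

/-- A poset is continuous if, for every `r`, the set of elements way-above `r` is a filter
whose infimum is `r`. -/
def IsContinuousPoset (L : Type*) [PartialOrder L] : Prop :=
  ∀ r : L, Order.IsPFilter {s : L | WayAbove s r} ∧ IsGLB {s : L | WayAbove s r} r

/-- A poset is filtered-complete if every filter has an infimum. -/
def IsFilteredComplete (L : Type*) [PartialOrder L] : Prop :=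
  ∀ F : Set L, Order.IsPFilter F → ∃ m : L, IsGLB F m

/-- A domain is a filtered-complete continuous poset. -/
def IsFilteredDomain (L : Type*) [PartialOrder L] : Prop :=
  IsFilteredComplete L ∧ IsContinuousPoset L

end Domain

/-! ### Borel sets of a topological space that need not be Hausdorff

The saturation of a set `A` (the intersection of all open sets containing `A`) is Mathlib's
`nhdsKer A`. -/

section Borel

/-- A set is saturated if it is an intersection of open sets, i.e. equal to its saturation. -/
def IsSaturatedSet {E : Type*} [TopologicalSpace E] (A : Set E) : Prop :=
  nhdsKer A = A

/-- The σ-algebra generated by the open sets and the compact saturated sets. -/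
abbrev saturatedBorel (E : Type*) [TopologicalSpace E] : MeasurableSpace E :=
  MeasurableSpace.generateFrom
    ({G : Set E | IsOpen G} ∪ {Q : Set E | IsCompact Q ∧ IsSaturatedSet Q})

/-- The collection of Borel subsets of `E`. -/
abbrev BorelSet (E : Type*) [TopologicalSpace E] : Type _ :=
  {B : Set E // @MeasurableSet E (saturatedBorel E) B}

/-- The empty Borel set. -/
def BorelSet.empty (E : Type*) [TopologicalSpace E] : BorelSet E :=
  ⟨∅, @MeasurableSet.empty E (saturatedBorel E)⟩

/-- The saturation of a compact set is compact and saturated, hence Borel. -/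
theorem measurableSet_nhdsKer_of_isCompact {E : Type*} [TopologicalSpace E] {K : Set E}
    (hK : IsCompact K) : @MeasurableSet E (saturatedBorel E) (nhdsKer K) := by
  refine MeasurableSpace.measurableSet_generateFrom (Or.inr ⟨?_, ?_⟩)
  · exact hK.nhdsKer
  · exact Set.Subset.antisymm
      (fun x hx => mem_nhdsKer.2 fun U hU hKU =>
        mem_nhdsKer.1 hx U hU (nhdsKer_minimal hKU hU))
      subset_nhdsKer

/-- The saturation of a compact Borel set, as a Borel set. -/
def BorelSet.saturation {E : Type*} [TopologicalSpace E] (K : BorelSet E)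
    (hK : IsCompact (K : Set E)) : BorelSet E :=
  ⟨nhdsKer (K : Set E), measurableSet_nhdsKer_of_isCompact hK⟩

end Borel

/-! ### Maxitive measures

All suprema and infima below are expressed by `IsLUB` and `IsGLB`, so that each definition
contains the assertion that the supremum or infimum exists. -/

section Maxitive

variable {E L : Type*} [TopologicalSpace E] [PartialOrder L]

/-- `ν` preserves the supremum of the family `𝒜` of Borel sets whenever the union of `𝒜` is
Borel. -/
def PreservesUnion (ν : BorelSet E → L) (𝒜 : Set (BorelSet E)) : Prop :=
  ∀ B : BorelSet E, (B : Set E) = ⋃ A ∈ 𝒜, (A : Set E) → IsLUB (ν '' 𝒜) (ν B)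

/-- Maxitive measure. -/
def IsMaxitive [OrderBot L] (ν : BorelSet E → L) : Prop :=
  ν (BorelSet.empty E) = ⊥ ∧ ∀ 𝒜 : Set (BorelSet E), 𝒜.Finite → PreservesUnion ν 𝒜

/-- `σ`-maxitive measure. -/
def IsSigmaMaxitive [OrderBot L] (ν : BorelSet E → L) : Prop :=
  ν (BorelSet.empty E) = ⊥ ∧ ∀ 𝒜 : Set (BorelSet E), 𝒜.Countable → PreservesUnion ν 𝒜

/-- Completely maxitive measure. -/
def IsCompletelyMaxitive [OrderBot L] (ν : BorelSet E → L) : Prop :=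
  ν (BorelSet.empty E) = ⊥ ∧ ∀ 𝒜 : Set (BorelSet E), PreservesUnion ν 𝒜

/-- The set of values `ν G`, for `G` open containing `A`. -/
def openValues (ν : BorelSet E → L) (A : Set E) : Set L :=
  {r : L | ∃ G : BorelSet E, IsOpen (G : Set E) ∧ A ⊆ (G : Set E) ∧ r = ν G}

/-- `ν B` is the supremum of the values of `ν` on saturations of compact Borel subsets of `B`,
for all Borel sets `B`. -/
def IsInnerContinuous (ν : BorelSet E → L) : Prop :=
  ∀ B : BorelSet E,
    IsLUB {r : L | ∃ (K : BorelSet E) (hK : IsCompact (K : Set E)),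
      (K : Set E) ⊆ (B : Set E) ∧ r = ν (K.saturation hK)} (ν B)

/-- `ν B` is the infimum of the values of `ν` on open sets containing `B`, for all Borel
sets `B`. -/
def IsOuterContinuous (ν : BorelSet E → L) : Prop :=
  ∀ B : BorelSet E, IsGLB (openValues ν (B : Set E)) (ν B)

/-- Regularity: inner- and outer-continuity. -/
def IsRegularMaxitive (ν : BorelSet E → L) : Prop :=
  IsInnerContinuous ν ∧ IsOuterContinuous ν

/-- `ν G` is the supremum of the values `ν⁺ K` over compact Borel sets `K ⊆ G`, for all open
sets `G`; here `ν⁺ K` is the infimum of the values of `ν` on open sets containing `K` (it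
exists if `ν` is maxitive and `L` is filtered-complete). -/
def IsWeaklyInnerContinuous (ν : BorelSet E → L) : Prop :=
  ∀ G : BorelSet E, IsOpen (G : Set E) →
    IsLUB {r : L | ∃ K : BorelSet E, IsCompact (K : Set E) ∧ (K : Set E) ⊆ (G : Set E) ∧
      IsGLB (openValues ν (K : Set E)) r} (ν G)

/-- `ν K` is the infimum of the values of `ν` on open sets containing `K`, for all compact
Borel sets `K`. -/
def IsWeaklyOuterContinuous (ν : BorelSet E → L) : Prop :=
  ∀ K : BorelSet E, IsCompact (K : Set E) → IsGLB (openValues ν (K : Set E)) (ν K)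

/-- Smoothness with respect to a collection `𝒞` of Borel sets that is closed under filtered
intersections: `ν (⋂ 𝒜)` is the infimum of the values of `ν` on `𝒜`, for all nonempty filtered
`𝒜 ⊆ 𝒞`. -/
def IsSmoothOn (𝒞 : Set (BorelSet E)) (ν : BorelSet E → L) : Prop :=
  ∀ 𝒜 : Set (BorelSet E), 𝒜 ⊆ 𝒞 → 𝒜.Nonempty →
    DirectedOn (fun A B : BorelSet E => (B : Set E) ⊆ (A : Set E)) 𝒜 →
    ∀ Q : BorelSet E, (Q : Set E) = ⋂ A ∈ 𝒜, (A : Set E) → IsGLB (ν '' 𝒜) (ν Q)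

/-- Smoothness with respect to the collection of compact saturated sets. In a quasisober space
this collection is closed under filtered intersections. -/
def IsQSmooth (ν : BorelSet E → L) : Prop :=
  IsSmoothOn {Q : BorelSet E | IsCompact (Q : Set E) ∧ IsSaturatedSet (Q : Set E)} ν

/-- `ν` is saturated if it takes the same value on a compact Borel set and on its
saturation. -/
def IsSaturatedMaxitive (ν : BorelSet E → L) : Prop :=
  ∀ (K : BorelSet E) (hK : IsCompact (K : Set E)), ν K = ν (K.saturation hK)

/-- `c` is a cardinal density of `ν`: `ν B` is the supremum of `c` on `B`, for all Borel
sets `B`. -/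
def IsCardinalDensity (c : E → L) (ν : BorelSet E → L) : Prop :=
  ∀ B : BorelSet E, IsLUB (c '' (B : Set E)) (ν B)

/-- Upper-semicontinuity of a poset-valued map: all sets `{x | t ≫ c x}` are open. -/
def IsUSC (c : E → L) : Prop :=
  ∀ t : L, IsOpen {x : E | WayAbove t (c x)}

/-- `ν` has a cardinal density. -/
def HasCardinalDensity (ν : BorelSet E → L) : Prop :=
  ∃ c : E → L, IsCardinalDensity c ν

/-- `ν` has an upper-semicontinuous cardinal density. -/
def HasUSCCardinalDensity (ν : BorelSet E → L) : Prop :=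
  ∃ c : E → L, IsUSC c ∧ IsCardinalDensity c ν

end Maxitive

/-!
Let `[x]` be the set of points inseparable from `x`. It is the smallest Borel set containing `x`,
so `c x = ν [x]` is the only natural candidate for a density, and `ν` has a density iff it is
completely maxitive.

Suppose that `c` is usc and that `t` is way above an upper bound of `c` on a Borel set `B`. Then
`{x | t ≫ c x}` is an open set containing `B` on which `c ≤ t`. Hence it suffices to compute `ν` on
open sets, and the resulting density makes `ν` outer-continuous. Weak outer-continuity makes `c`
usc (by interpolation of `≫`) and computes `ν` on compact sets (by finite subcovers); weak
inner-continuity, or `σ`-maxitivity when open sets are Lindelöf or `σ`-compact, passes from compact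
to open sets.

Quasisobriety enters through well-filteredness: an open set that contains a filtered intersection
of compact saturated sets contains one of them. Conversely, `𝒬`-smoothness is exploited on families
of compact sets that shrink to a compact set: compact neighbourhoods in a locally compact space,
traces of closed neighbourhoods in a regular one, tails of convergent sequences in a
Fréchet–Urysohn one.
-/

open Set Filter Topology MeasureTheory

/-! ### Continuous posets -/

section WayAbove

variable {L : Type*} [PartialOrder L] {s s' t r r' m : L}

theorem WayAbove.le (h : WayAbove s r) : r ≤ s :=
  h (Ici r) r (Order.PFilter.principal r).isPFilter isGLB_Ici le_rfl

theorem WayAbove.mono (h : WayAbove s r) (hs : s ≤ s') (hr : r' ≤ r) : WayAbove s' r' :=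
  fun F m hF hm hmr => Order.PFilter.mem_of_le (F := hF.toPFilter) hs (h F m hF hm (hmr.trans hr))

theorem isPFilter_upperClosure {D : Set L} (hne : D.Nonempty) (hD : DirectedOn (· ≥ ·) D) :
    Order.IsPFilter (upperClosure D : Set L) := by
  refine .of_def (hne.mono subset_upperClosure) ?_ fun hxy hx => (upperClosure D).upper hxy hx
  rintro x ⟨a, ha, hax⟩ y ⟨b, hb, hby⟩
  obtain ⟨d, hd, hda, hdb⟩ := hD a ha b hb
  exact ⟨d, subset_upperClosure hd, hda.trans hax, hdb.trans hby⟩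

theorem WayAbove.exists_le_of_isGLB (h : WayAbove s m) {D : Set L} (hne : D.Nonempty)
    (hD : DirectedOn (· ≥ ·) D) (hm : IsGLB D m) : ∃ d ∈ D, d ≤ s :=
  h (upperClosure D) m (isPFilter_upperClosure hne hD)
    (by rwa [IsGLB, lowerBounds_upperClosure]) le_rfl

theorem IsContinuousPoset.le_of_forall_wayAbove (hL : IsContinuousPoset L)
    (h : ∀ t, WayAbove t r → s ≤ t) : s ≤ r :=
  (hL r).2.2 h

theorem IsContinuousPoset.isPFilter_setOf_exists_wayAbove_between (hL : IsContinuousPoset L)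
    (r : L) : Order.IsPFilter {t | ∃ s, WayAbove t s ∧ WayAbove s r} := by
  refine .of_def ?_ ?_ fun hxy ⟨a, hxa, ha⟩ => ⟨a, hxa.mono hxy le_rfl, ha⟩
  · obtain ⟨a, ha⟩ := (hL r).1.Nonempty
    obtain ⟨b, hb⟩ := (hL a).1.Nonempty
    exact ⟨b, a, hb, ha⟩
  · rintro x ⟨a, hxa, ha⟩ y ⟨b, hyb, hb⟩
    obtain ⟨c, hc, hca, hcb⟩ := (hL r).1.Directed a ha b hb
    obtain ⟨z, hz, hzx, hzy⟩ :=
      (hL c).1.Directed x (hxa.mono le_rfl hca) y (hyb.mono le_rfl hcb)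
    exact ⟨z, ⟨c, hz, hc⟩, hzx, hzy⟩

theorem IsContinuousPoset.exists_wayAbove_between (hL : IsContinuousPoset L)
    (h : WayAbove t r) : ∃ s, WayAbove t s ∧ WayAbove s r := by
  refine h _ r (hL.isPFilter_setOf_exists_wayAbove_between r) ⟨?_, fun l hl => ?_⟩ le_rfl
  · rintro x ⟨a, hxa, ha⟩
    exact ha.le.trans hxa.le
  · exact hL.le_of_forall_wayAbove fun s hs =>
      hL.le_of_forall_wayAbove fun t ht => hl ⟨s, ht, hs⟩

end WayAbove

/-! ### Classes of inseparable points -/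

section BorelSets

variable {E : Type*} [TopologicalSpace E] {x y : E}

theorem measurableSet_saturatedBorel_of_isOpen {G : Set E} (hG : IsOpen G) :
    MeasurableSet[saturatedBorel E] G :=
  MeasurableSpace.measurableSet_generateFrom (.inl hG)

theorem measurableSet_saturatedBorel_of_isClosed {F : Set E} (hF : IsClosed F) :
    MeasurableSet[saturatedBorel E] F :=
  .of_compl (measurableSet_saturatedBorel_of_isOpen hF.isOpen_compl)

theorem IsSaturatedSet.mem_of_specializes {A : Set E} (hA : IsSaturatedSet A)
    (h : x ⤳ y) (hy : y ∈ A) : x ∈ A :=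
  hA ▸ mem_nhdsKer_iff_specializes.2 ⟨y, hy, h⟩

theorem BorelSet.mem_iff_of_inseparable (B : BorelSet E) (h : Inseparable x y) :
    x ∈ (B : Set E) ↔ y ∈ (B : Set E) := by
  obtain ⟨B, hB⟩ := B
  induction B, hB using MeasurableSpace.generateFrom_induction with
  | hC t ht =>
    rcases ht with ht | ⟨-, ht⟩
    · exact h.mem_open_iff ht
    · exact ⟨ht.mem_of_specializes h.specializes', ht.mem_of_specializes h.specializes⟩
  | empty => exact Iff.rfl
  | compl t _ ih => exact not_congr ih
  | iUnion s _ ih => simpa only [mem_iUnion] using exists_congr ih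

/-- An open set, as a Borel set. -/
def BorelSet.ofIsOpen {G : Set E} (hG : IsOpen G) : BorelSet E :=
  ⟨G, measurableSet_saturatedBorel_of_isOpen hG⟩

/-- The saturation of a compact set, as a Borel set. Unlike in `BorelSet.saturation`, the compact
set itself need not be Borel. -/
def BorelSet.compactSaturation {K : Set E} (hK : IsCompact K) : BorelSet E :=
  ⟨nhdsKer K, measurableSet_nhdsKer_of_isCompact hK⟩

/-- The class of points that are inseparable from `x`: the smallest Borel set containing `x`. It is
encoded as the intersection of the saturation and the closure of `{x}`. -/
def BorelSet.inseparableClass (x : E) : BorelSet E :=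
  ⟨nhdsKer {x} ∩ closure {x}, (measurableSet_nhdsKer_of_isCompact isCompact_singleton).inter
    (measurableSet_saturatedBorel_of_isClosed isClosed_closure)⟩

theorem BorelSet.mem_inseparableClass : y ∈ (inseparableClass x : Set E) ↔ Inseparable y x := by
  change y ∈ nhdsKer {x} ∩ closure {x} ↔ _
  rw [inseparable_iff_specializes_and, mem_inter_iff, mem_nhdsKer_singleton,
    specializes_iff_mem_closure (x := x)]

theorem BorelSet.mem_inseparableClass_self (x : E) : x ∈ (inseparableClass x : Set E) :=
  mem_inseparableClass.2 .rfl

theorem BorelSet.isCompact_inseparableClass (x : E) : IsCompact (inseparableClass x : Set E) :=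
  isCompact_singleton.nhdsKer.inter_right isClosed_closure

theorem BorelSet.inseparableClass_le {B : BorelSet E} (hx : x ∈ (B : Set E)) :
    inseparableClass x ≤ B :=
  fun _ hy => (B.mem_iff_of_inseparable (mem_inseparableClass.1 hy)).2 hx

theorem BorelSet.biUnion_inseparableClass (B : BorelSet E) :
    ⋃ x ∈ (B : Set E), (inseparableClass x : Set E) = B :=
  Subset.antisymm (iUnion₂_subset fun _ hx => inseparableClass_le hx)
    fun x hx => mem_biUnion hx (mem_inseparableClass_self x)

end BorelSets

/-! ### Ideals of Borel sets of small measure -/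

section Maxitive

variable {E L : Type*} [TopologicalSpace E] [PartialOrder L] [OrderBot L] {ν : BorelSet E → L}

theorem IsMaxitive.monotone (hν : IsMaxitive ν) : Monotone ν := by
  intro A B h
  have hsup : IsLUB (ν '' {A, B}) (ν B) :=
    hν.2 {A, B} (toFinite _) B (by rw [biUnion_pair]; exact (union_eq_self_of_subset_left h).symm)
  exact hsup.1 (mem_image_of_mem ν (mem_insert _ _))

theorem IsMaxitive.isLUB_union (hν : IsMaxitive ν) (A B : BorelSet E) :
    IsLUB {ν A, ν B} (ν ⟨A ∪ B, A.2.union B.2⟩) := by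
  rw [← image_pair]
  exact hν.2 {A, B} (toFinite _) _ (biUnion_pair A B _).symm

theorem IsSigmaMaxitive.isMaxitive (hν : IsSigmaMaxitive ν) : IsMaxitive ν :=
  ⟨hν.1, fun 𝒜 h𝒜 => hν.2 𝒜 h𝒜.countable⟩

theorem IsCompletelyMaxitive.isSigmaMaxitive (hν : IsCompletelyMaxitive ν) : IsSigmaMaxitive ν :=
  ⟨hν.1, fun 𝒜 _ => hν.2 𝒜⟩

end Maxitive

section BorelCover

variable {E L : Type*} [TopologicalSpace E] [PartialOrder L] {ν : BorelSet E → L} {t : L}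

/-- `S`, which need not be Borel, is contained in a Borel set of measure at most `t`. For a maxitive
(resp. `σ`-maxitive) measure such sets form an ideal (resp. a `σ`-ideal), hence on a compact
(resp. Lindelöf) set this property can be checked locally. -/
def HasBorelCoverLE (ν : BorelSet E → L) (t : L) (S : Set E) : Prop :=
  ∃ B : BorelSet E, S ⊆ B ∧ ν B ≤ t

theorem HasBorelCoverLE.subset {S T : Set E} (hT : HasBorelCoverLE ν t T) (h : S ⊆ T) :
    HasBorelCoverLE ν t S :=
  let ⟨B, hTB, hB⟩ := hT; ⟨B, h.trans hTB, hB⟩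

theorem HasBorelCoverLE.le (hν : Monotone ν) {B : BorelSet E} (h : HasBorelCoverLE ν t B) :
    ν B ≤ t :=
  let ⟨_, hBA, hA⟩ := h; (hν hBA).trans hA

variable [OrderBot L]

theorem IsMaxitive.hasBorelCoverLE_union (hν : IsMaxitive ν) {S T : Set E}
    (hS : HasBorelCoverLE ν t S) (hT : HasBorelCoverLE ν t T) : HasBorelCoverLE ν t (S ∪ T) := by
  obtain ⟨A, hSA, hA⟩ := hS
  obtain ⟨B, hTB, hB⟩ := hT
  refine ⟨⟨A ∪ B, A.2.union B.2⟩, union_subset_union hSA hTB, (hν.isLUB_union A B).2 ?_⟩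
  rintro _ (rfl | rfl) <;> assumption

theorem IsSigmaMaxitive.hasBorelCoverLE_sUnion (hν : IsSigmaMaxitive ν) {𝒮 : Set (Set E)}
    (hc : 𝒮.Countable) (h : ∀ S ∈ 𝒮, HasBorelCoverLE ν t S) : HasBorelCoverLE ν t (⋃₀ 𝒮) := by
  choose! A hSA hA using h
  let U : BorelSet E := ⟨⋃ B ∈ A '' 𝒮, (B : Set E), .biUnion (hc.image A) fun B _ => B.2⟩
  have hU : ν U ≤ t := (hν.2 (A '' 𝒮) (hc.image A) U rfl).2 <| by
    rintro _ ⟨_, ⟨S, hS, rfl⟩, rfl⟩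
    exact hA S hS
  refine ⟨U, sUnion_subset fun S hS => (hSA S hS).trans ?_, hU⟩
  exact subset_biUnion_of_mem (u := ((↑) : BorelSet E → Set E)) (mem_image_of_mem A hS)

theorem IsMaxitive.le_of_isCompact (hν : IsMaxitive ν) {K : BorelSet E}
    (hK : IsCompact (K : Set E)) (h : ∀ x ∈ (K : Set E), ∃ S ∈ 𝓝[(K : Set E)] x,
      HasBorelCoverLE ν t S) : ν K ≤ t :=
  HasBorelCoverLE.le hν.monotone <|
    hK.induction_on ⟨.empty E, empty_subset _, hν.1.trans_le bot_le⟩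
      (fun _ _ hST hT => hT.subset hST) (fun _ _ => hν.hasBorelCoverLE_union) h

theorem IsSigmaMaxitive.le_of_isLindelof (hν : IsSigmaMaxitive ν) {B : BorelSet E}
    (hB : IsLindelof (B : Set E)) (h : ∀ x ∈ (B : Set E), ∃ S ∈ 𝓝[(B : Set E)] x,
      HasBorelCoverLE ν t S) : ν B ≤ t :=
  HasBorelCoverLE.le hν.isMaxitive.monotone <|
    hB.induction_on (fun _ _ hST hT => hT.subset hST) (fun _ => hν.hasBorelCoverLE_sUnion) h

theorem IsSigmaMaxitive.le_of_isSigmaCompact (hν : IsSigmaMaxitive ν) {G : BorelSet E}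
    (hG : IsOpen (G : Set E)) (hσ : IsSigmaCompact (G : Set E))
    (h : ∀ K : BorelSet E, IsCompact (K : Set E) → K ≤ G → ν K ≤ t) : ν G ≤ t := by
  obtain ⟨K, hK, hKG⟩ := hσ
  refine HasBorelCoverLE.le hν.isMaxitive.monotone ?_
  rw [← hKG, ← sUnion_range]
  refine hν.hasBorelCoverLE_sUnion (countable_range K) (forall_mem_range.2 fun n => ?_)
  have hnG : nhdsKer (K n) ⊆ G := nhdsKer_minimal (hKG ▸ subset_iUnion K n) hG
  exact ⟨.compactSaturation (hK n), subset_nhdsKer, h _ (hK n).nhdsKer hnG⟩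

end BorelCover

/-! ### Outer approximation -/

section OpenValues

variable {E L : Type*} [TopologicalSpace E]

theorem openValues_nhdsKer (ν : BorelSet E → L) (A : Set E) :
    openValues ν (nhdsKer A) = openValues ν A := by
  ext r
  exact exists_congr fun G => and_congr_right fun hG => by rw [hG.nhdsKer_subset]

theorem openValues_nonempty (ν : BorelSet E → L) (A : Set E) : (openValues ν A).Nonempty :=
  ⟨_, .ofIsOpen isOpen_univ, isOpen_univ, subset_univ A, rfl⟩

variable [PartialOrder L] {ν : BorelSet E → L}

theorem directedOn_openValues (hν : Monotone ν) (A : Set E) :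
    DirectedOn (· ≥ ·) (openValues ν A) := by
  rintro _ ⟨G, hG, hAG, rfl⟩ _ ⟨H, hH, hAH, rfl⟩
  exact ⟨_, ⟨.ofIsOpen (hG.inter hH), hG.inter hH, subset_inter hAG hAH, rfl⟩,
    hν inter_subset_left, hν inter_subset_right⟩

theorem mem_lowerBounds_openValues (hν : Monotone ν) (B : BorelSet E) :
    ν B ∈ lowerBounds (openValues ν B) := by
  rintro _ ⟨G, -, hBG, rfl⟩
  exact hν hBG

theorem IsOuterContinuous.isWeaklyOuterContinuous (h : IsOuterContinuous ν) :
    IsWeaklyOuterContinuous ν :=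
  fun K _ => h K

theorem IsWeaklyOuterContinuous.isSaturatedMaxitive (h : IsWeaklyOuterContinuous ν) :
    IsSaturatedMaxitive ν := by
  intro K hK
  have hsat : IsGLB (openValues ν (nhdsKer (K : Set E))) (ν (K.saturation hK)) :=
    h (K.saturation hK) hK.nhdsKer
  rw [openValues_nhdsKer] at hsat
  exact (h K hK).unique hsat

theorem IsRegularMaxitive.isWeaklyInnerContinuous (h : IsRegularMaxitive ν) :
    IsWeaklyInnerContinuous ν := by
  intro G _
  have hs : IsSaturatedMaxitive ν := h.2.isWeaklyOuterContinuous.isSaturatedMaxitive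
  convert h.1 G using 3 with r
  refine exists_congr fun K => ⟨?_, ?_⟩
  · rintro ⟨hK, hKG, hr⟩
    exact ⟨hK, hKG, (hr.unique (h.2 K)).trans (hs K hK)⟩
  · rintro ⟨hK, hKG, rfl⟩
    exact ⟨hK, hKG, hs K hK ▸ h.2 K⟩

end OpenValues

/-! ### Cardinal densities -/

section Density

variable {E L : Type*} [TopologicalSpace E]

/-- The canonical candidate for a cardinal density of `ν`. The classes of inseparable points play
the role of the singletons, which need not be Borel. -/
def pointDensity (ν : BorelSet E → L) (x : E) : L :=
  ν (.inseparableClass x)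

variable [PartialOrder L] {ν : BorelSet E → L} {x : E} {t u : L}

theorem pointDensity_le (hν : Monotone ν) {B : BorelSet E} (hx : x ∈ (B : Set E)) :
    pointDensity ν x ≤ ν B :=
  hν (BorelSet.inseparableClass_le hx)

theorem HasBorelCoverLE.pointDensity_le (hν : Monotone ν) {S : Set E} (h : HasBorelCoverLE ν t S)
    (hx : x ∈ S) : pointDensity ν x ≤ t :=
  let ⟨_, hSB, hB⟩ := h; (_root_.pointDensity_le hν (hSB hx)).trans hB

theorem isCardinalDensity_pointDensity_of_isUSC (hL : IsContinuousPoset L) (hν : Monotone ν)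
    (husc : IsUSC (pointDensity ν)) (hopen : ∀ G : BorelSet E, IsOpen (G : Set E) →
      ∀ u ∈ upperBounds (pointDensity ν '' G), ν G ≤ u) :
    IsCardinalDensity (pointDensity ν) ν := by
  refine fun B => ⟨forall_mem_image.2 fun x hx => pointDensity_le hν hx,
    fun u hu => hL.le_of_forall_wayAbove fun t ht => ?_⟩
  have hB : (B : Set E) ⊆ {x | WayAbove t (pointDensity ν x)} :=
    fun x hx => ht.mono le_rfl (hu (mem_image_of_mem _ hx))
  calc ν B ≤ ν (.ofIsOpen (husc t)) := hν hB
    _ ≤ t := hopen _ (husc t) t (forall_mem_image.2 fun _ hx => WayAbove.le hx)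

theorem IsCardinalDensity.monotone {c : E → L} (hc : IsCardinalDensity c ν) : Monotone ν :=
  fun A B h => (hc A).mono (hc B) (image_mono h)

theorem IsCardinalDensity.isOuterContinuous (hL : IsContinuousPoset L) {c : E → L}
    (husc : IsUSC c) (hc : IsCardinalDensity c ν) : IsOuterContinuous ν := by
  refine fun B => ⟨mem_lowerBounds_openValues hc.monotone B, fun l hl =>
    hL.le_of_forall_wayAbove fun t ht => ?_⟩
  have hB : (B : Set E) ⊆ {x | WayAbove t (c x)} :=
    fun x hx => ht.mono le_rfl ((hc B).1 (mem_image_of_mem c hx))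
  calc l ≤ ν (.ofIsOpen (husc t)) := hl ⟨_, husc t, hB, rfl⟩
    _ ≤ t := (hc _).2 (forall_mem_image.2 fun _ hx => WayAbove.le hx)

theorem IsWeaklyOuterContinuous.exists_mem_nhds_hasBorelCoverLE (hν : Monotone ν)
    (h : IsWeaklyOuterContinuous ν) (ht : WayAbove t (pointDensity ν x)) :
    ∃ S ∈ 𝓝 x, HasBorelCoverLE ν t S := by
  obtain ⟨_, ⟨G, hG, hxG, rfl⟩, hGt⟩ := ht.exists_le_of_isGLB (openValues_nonempty ν _)
    (directedOn_openValues hν _) (h _ (BorelSet.isCompact_inseparableClass x))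
  exact ⟨G, hG.mem_nhds (hxG (BorelSet.mem_inseparableClass_self x)), G, Subset.rfl, hGt⟩

theorem IsWeaklyOuterContinuous.isUSC_pointDensity (hL : IsContinuousPoset L) (hν : Monotone ν)
    (h : IsWeaklyOuterContinuous ν) : IsUSC (pointDensity ν) := by
  refine fun t => isOpen_iff_mem_nhds.2 fun x hx => ?_
  obtain ⟨s, hts, hs⟩ := hL.exists_wayAbove_between hx
  obtain ⟨S, hS, hSs⟩ := h.exists_mem_nhds_hasBorelCoverLE hν hs
  exact mem_of_superset hS fun y hy => hts.mono le_rfl (hSs.pointDensity_le hν hy)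

variable [OrderBot L]

theorem IsCardinalDensity.isCompletelyMaxitive {c : E → L} (hc : IsCardinalDensity c ν) :
    IsCompletelyMaxitive ν := by
  refine ⟨?_, fun 𝒜 B hB => ⟨?_, fun u hu => (hc B).2 ?_⟩⟩
  · exact le_bot_iff.1 ((hc (.empty E)).2 (forall_mem_image.2 fun _ hx => hx.elim))
  · refine forall_mem_image.2 fun A hA => hc.monotone (?_ : (A : Set E) ⊆ B)
    exact hB ▸ subset_biUnion_of_mem (u := ((↑) : BorelSet E → Set E)) hA
  · refine forall_mem_image.2 fun x hx => ?_
    obtain ⟨A, hA, hxA⟩ := mem_iUnion₂.1 (hB ▸ hx)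
    exact ((hc A).1 (mem_image_of_mem c hxA)).trans (hu (mem_image_of_mem ν hA))

theorem IsCompletelyMaxitive.isCardinalDensity_pointDensity (h : IsCompletelyMaxitive ν) :
    IsCardinalDensity (pointDensity ν) ν := by
  intro B
  have hsup := h.2 (BorelSet.inseparableClass '' B) B
    (by rw [biUnion_image, B.biUnion_inseparableClass])
  rwa [image_image] at hsup

theorem hasCardinalDensity_iff_isCompletelyMaxitive :
    HasCardinalDensity ν ↔ IsCompletelyMaxitive ν :=
  ⟨fun ⟨_, hc⟩ => hc.isCompletelyMaxitive, fun h => ⟨_, h.isCardinalDensity_pointDensity⟩⟩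

theorem IsCompletelyMaxitive.isInnerContinuous (h : IsCompletelyMaxitive ν)
    (hs : IsSaturatedMaxitive ν) : IsInnerContinuous ν := by
  have hc := h.isCardinalDensity_pointDensity
  refine fun B => ⟨?_, fun u hu => (hc B).2 (forall_mem_image.2 fun x hx => ?_)⟩
  · rintro _ ⟨K, hK, hKB, rfl⟩
    exact (hs K hK).symm.trans_le (hc.monotone hKB)
  · exact hu ⟨_, BorelSet.isCompact_inseparableClass x, BorelSet.inseparableClass_le hx, hs _ _⟩

theorem IsWeaklyOuterContinuous.le_of_isCompact (hL : IsContinuousPoset L) (hν : IsMaxitive ν)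
    (h : IsWeaklyOuterContinuous ν) {K : BorelSet E} (hK : IsCompact (K : Set E))
    (hu : u ∈ upperBounds (pointDensity ν '' K)) : ν K ≤ u := by
  refine hL.le_of_forall_wayAbove fun t ht => hν.le_of_isCompact hK fun x hx => ?_
  obtain ⟨S, hS, hSt⟩ := h.exists_mem_nhds_hasBorelCoverLE hν.monotone
    (ht.mono le_rfl (hu (mem_image_of_mem _ hx)))
  exact ⟨S, mem_nhdsWithin_of_mem_nhds hS, hSt⟩

theorem IsWeaklyInnerContinuous.hasUSCCardinalDensity (hL : IsContinuousPoset L)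
    (hν : IsMaxitive ν) (hi : IsWeaklyInnerContinuous ν) (ho : IsWeaklyOuterContinuous ν) :
    HasUSCCardinalDensity ν := by
  have husc := ho.isUSC_pointDensity hL hν.monotone
  refine ⟨_, husc, isCardinalDensity_pointDensity_of_isUSC hL hν.monotone husc fun G hG u hu =>
    (hi G hG).2 ?_⟩
  rintro _ ⟨K, hK, hKG, hr⟩
  rw [hr.unique (ho K hK)]
  exact ho.le_of_isCompact hL hν hK (upperBounds_mono_set (image_mono hKG) hu)

theorem IsMaxitive.isRegularMaxitive_tfae (hL : IsContinuousPoset L) (hν : IsMaxitive ν) :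
    [IsRegularMaxitive ν,
      HasUSCCardinalDensity ν,
      IsOuterContinuous ν ∧ IsCompletelyMaxitive ν,
      IsWeaklyOuterContinuous ν ∧ IsWeaklyInnerContinuous ν].TFAE := by
  tfae_have 1 → 4 := fun h => ⟨h.2.isWeaklyOuterContinuous, h.isWeaklyInnerContinuous⟩
  tfae_have 4 → 2 := fun h => h.2.hasUSCCardinalDensity hL hν h.1
  tfae_have 2 → 3 := fun ⟨_, husc, hc⟩ => ⟨hc.isOuterContinuous hL husc, hc.isCompletelyMaxitive⟩
  tfae_have 3 → 1 := fun h =>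
    ⟨h.2.isInnerContinuous h.1.isWeaklyOuterContinuous.isSaturatedMaxitive, h.1⟩
  tfae_finish

theorem IsWeaklyOuterContinuous.hasUSCCardinalDensity [HereditarilyLindelofSpace E]
    (hL : IsContinuousPoset L) (h : IsWeaklyOuterContinuous ν) (hσ : IsSigmaMaxitive ν) :
    HasUSCCardinalDensity ν := by
  have hν := hσ.isMaxitive.monotone
  have husc := h.isUSC_pointDensity hL hν
  refine ⟨_, husc, isCardinalDensity_pointDensity_of_isUSC hL hν husc fun G _ u hu =>
    hL.le_of_forall_wayAbove fun t ht => ?_⟩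
  refine hσ.le_of_isLindelof (HereditarilyLindelofSpace.isLindelof (G : Set E)) fun x hx => ?_
  obtain ⟨S, hS, hSt⟩ := h.exists_mem_nhds_hasBorelCoverLE hν
    (ht.mono le_rfl (hu (mem_image_of_mem _ hx)))
  exact ⟨S, mem_nhdsWithin_of_mem_nhds hS, hSt⟩

end Density

/-! ### Well-filteredness of quasisober spaces -/

section WellFiltered

variable {E : Type*} [TopologicalSpace E] {𝒬 : Set (Set E)}

theorem exists_minimal_isClosed_inter_nonempty (hc : ∀ Q ∈ 𝒬, IsCompact Q) {F : Set E}
    (hF : IsClosed F) (hQF : ∀ Q ∈ 𝒬, (Q ∩ F).Nonempty) :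
    ∃ C ⊆ F, Minimal (· ∈ {C | IsClosed C ∧ ∀ Q ∈ 𝒬, (Q ∩ C).Nonempty}) C := by
  refine zorn_superset_nonempty {C | IsClosed C ∧ ∀ Q ∈ 𝒬, (Q ∩ C).Nonempty}
    (fun c hcS hchain hcne => ⟨⋂₀ c, ⟨isClosed_sInter fun C hC => (hcS hC).1, fun Q hQ => ?_⟩,
      fun C => sInter_subset_of_mem⟩) F ⟨hF, hQF⟩
  have := hcne.to_subtype
  have hdir : Directed (· ⊇ ·) ((↑) : c → Set E) := directedOn_iff_directed.1 fun A hA B hB =>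
    (hchain.total hA hB).elim (fun h => ⟨A, hA, Subset.rfl, h⟩) fun h => ⟨B, hB, h, Subset.rfl⟩
  rw [sInter_eq_iInter]
  refine (hc Q hQ).inter_iInter_nonempty _ (fun C => (hcS C.2).1) fun s => ?_
  obtain ⟨D, hD⟩ := hdir.finset_le s
  exact ((hcS D.2).2 Q hQ).mono (inter_subset_inter_right _ (subset_iInter₂ hD))

theorem isIrreducible_of_minimal_isClosed_inter_nonempty (hne : 𝒬.Nonempty)
    (hdir : DirectedOn (· ⊇ ·) 𝒬) {C : Set E}
    (hC : Minimal (· ∈ {C | IsClosed C ∧ ∀ Q ∈ 𝒬, (Q ∩ C).Nonempty}) C) : IsIrreducible C := by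
  obtain ⟨⟨hCc, hCQ⟩, hmin⟩ := hC
  have exists_disjoint : ∀ A : Set E, IsClosed A → ¬C ⊆ A → ∃ Q ∈ 𝒬, Q ∩ (C ∩ A) = ∅ := by
    intro A hA hCA
    by_contra! hcon
    exact hCA ((hmin ⟨hCc.inter hA, hcon⟩ inter_subset_left).trans inter_subset_right)
  refine ⟨?_, isPreirreducible_iff_isClosed_union_isClosed.2 fun A B hA hB hAB => ?_⟩
  · obtain ⟨Q, hQ⟩ := hne
    exact (hCQ Q hQ).mono inter_subset_right
  · by_contra! hnot
    obtain ⟨Q, hQ, hQA⟩ := exists_disjoint A hA hnot.1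
    obtain ⟨R, hR, hRB⟩ := exists_disjoint B hB hnot.2
    obtain ⟨T, hT, hTQ, hTR⟩ := hdir Q hQ R hR
    obtain ⟨x, hxT, hxC⟩ := hCQ T hT
    rcases hAB hxC with hx | hx
    · exact hQA.subset ⟨hTQ hxT, hxC, hx⟩
    · exact hRB.subset ⟨hTR hxT, hxC, hx⟩

variable [QuasiSober E]

theorem exists_subset_of_sInter_subset_of_isSaturatedSet (hne : 𝒬.Nonempty)
    (hdir : DirectedOn (· ⊇ ·) 𝒬) (hc : ∀ Q ∈ 𝒬, IsCompact Q) (hs : ∀ Q ∈ 𝒬, IsSaturatedSet Q)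
    {G : Set E} (hG : IsOpen G) (h : ⋂₀ 𝒬 ⊆ G) : ∃ Q ∈ 𝒬, Q ⊆ G := by
  by_contra! hcon
  obtain ⟨C, hCG, hC⟩ := exists_minimal_isClosed_inter_nonempty hc hG.isClosed_compl
    fun Q hQ => inter_compl_nonempty_iff.2 (hcon Q hQ)
  -- The generic point of `C` lies in every `Q`, since `Q` is saturated and meets `C`.
  obtain ⟨x, hx⟩ := QuasiSober.sober
    (isIrreducible_of_minimal_isClosed_inter_nonempty hne hdir hC) hC.prop.1
  refine hCG hx.mem (h (mem_sInter.2 fun Q hQ => ?_))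
  obtain ⟨y, hyQ, hyC⟩ := hC.prop.2 Q hQ
  exact (hs Q hQ).mem_of_specializes (hx.specializes hyC) hyQ

theorem isCompact_sInter_of_isSaturatedSet (hne : 𝒬.Nonempty) (hdir : DirectedOn (· ⊇ ·) 𝒬)
    (hc : ∀ Q ∈ 𝒬, IsCompact Q) (hs : ∀ Q ∈ 𝒬, IsSaturatedSet Q) : IsCompact (⋂₀ 𝒬) := by
  refine isCompact_of_finite_subcover fun U hU hcov => ?_
  obtain ⟨Q, hQ, hQU⟩ := exists_subset_of_sInter_subset_of_isSaturatedSet hne hdir hc hs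
    (isOpen_iUnion hU) hcov
  obtain ⟨s, hs⟩ := (hc Q hQ).elim_finite_subcover U hU hQU
  exact ⟨s, (sInter_subset_of_mem hQ).trans hs⟩

theorem IsWeaklyOuterContinuous.isQSmooth {L : Type*} [PartialOrder L] {ν : BorelSet E → L}
    (hν : Monotone ν) (h : IsWeaklyOuterContinuous ν) : IsQSmooth ν := by
  intro 𝒜 h𝒜 hne hdir Q hQ
  have hdir' : DirectedOn (· ⊇ ·) (Subtype.val '' 𝒜) := directedOn_image.2 hdir
  have hc : ∀ A ∈ Subtype.val '' 𝒜, IsCompact A := forall_mem_image.2 fun A hA => (h𝒜 hA).1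
  have hs : ∀ A ∈ Subtype.val '' 𝒜, IsSaturatedSet A := forall_mem_image.2 fun A hA => (h𝒜 hA).2
  rw [← sInter_image] at hQ
  have hQc : IsCompact (Q : Set E) :=
    hQ ▸ isCompact_sInter_of_isSaturatedSet (hne.image _) hdir' hc hs
  refine ⟨forall_mem_image.2 fun A hA => hν (?_ : (Q : Set E) ⊆ A), fun l hl => (h Q hQc).2 ?_⟩
  · exact hQ ▸ sInter_subset_of_mem (mem_image_of_mem _ hA)
  · rintro _ ⟨G, hG, hQG, rfl⟩
    obtain ⟨_, ⟨A, hA, rfl⟩, hAG⟩ := exists_subset_of_sInter_subset_of_isSaturatedSet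
      (hne.image _) hdir' hc hs hG (hQ ▸ hQG)
    exact (hl (mem_image_of_mem ν hA)).trans (hν hAG)

end WellFiltered

/-! ### Smooth measures along shrinking families of compact sets -/

section Smooth

variable {E L : Type*} [TopologicalSpace E] [PartialOrder L] {ν : BorelSet E → L}

theorem IsQSmooth.isGLB_range_compactSaturation (h : IsQSmooth ν) (hs : IsSaturatedMaxitive ν)
    {ι : Type*} {K : ι → Set E} (hK : ∀ i, IsCompact (K i)) (hdir : Directed (· ⊇ ·) K)
    {C : BorelSet E} (hC : IsCompact (C : Set E)) (hCK : ∀ i, (C : Set E) ⊆ nhdsKer (K i))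
    (hKU : ∀ U : Set E, IsOpen U → (C : Set E) ⊆ U → ∃ i, K i ⊆ U) :
    IsGLB (range fun i => ν (.compactSaturation (hK i))) (ν C) := by
  obtain ⟨i, -⟩ := hKU univ isOpen_univ (subset_univ _)
  have hinter : nhdsKer (C : Set E) = ⋂ i, nhdsKer (K i) := by
    refine Subset.antisymm (subset_iInter fun i => ?_)
      (subset_nhdsKer_iff.2 fun U hU hCU => ?_)
    · simpa only [nhdsKer_nhdsKer] using nhdsKer_mono (hCK i)
    · obtain ⟨i, hi⟩ := hKU U hU hCU
      exact (iInter_subset _ i).trans (nhdsKer_minimal hi hU)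
  have hglb := h (range fun i => .compactSaturation (hK i)) ?_ ⟨_, mem_range_self i⟩ ?_
    (C.saturation hC) (hinter.trans (by rw [biInter_range]; rfl))
  · rwa [← range_comp', ← hs C hC] at hglb
  · exact range_subset_iff.2 fun i => ⟨(hK i).nhdsKer, nhdsKer_nhdsKer (K i)⟩
  · rintro _ ⟨i, rfl⟩ _ ⟨j, rfl⟩
    obtain ⟨k, hki, hkj⟩ := hdir i j
    exact ⟨_, mem_range_self k, nhdsKer_mono hki, nhdsKer_mono hkj⟩

theorem IsQSmooth.isWeaklyOuterContinuous [LocallyCompactSpace E] (hν : Monotone ν)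
    (h : IsQSmooth ν) (hs : IsSaturatedMaxitive ν) : IsWeaklyOuterContinuous ν := by
  refine fun C hC => ⟨mem_lowerBounds_openValues hν C, fun l hl => ?_⟩
  let ι := {K : Set E // IsCompact K ∧ (C : Set E) ⊆ interior K}
  have exists_subset : ∀ U, IsOpen U → (C : Set E) ⊆ U → ∃ K : ι, (K : Set E) ⊆ U := by
    intro U hU hCU
    obtain ⟨K, hK, hCK, hKU⟩ := exists_compact_between hC hU hCU
    exact ⟨⟨K, hK, hCK⟩, hKU⟩
  have hdir : Directed (· ⊇ ·) ((↑) : ι → Set E) := fun K M => by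
    obtain ⟨N, hN⟩ := exists_subset _ (isOpen_interior.inter isOpen_interior)
      (subset_inter K.2.2 M.2.2)
    exact ⟨N, hN.trans (inter_subset_left.trans interior_subset),
      hN.trans (inter_subset_right.trans interior_subset)⟩
  refine (h.isGLB_range_compactSaturation hs (fun K : ι => K.2.1) hdir hC
    (fun K => (K.2.2.trans interior_subset).trans subset_nhdsKer) exists_subset).2
    (forall_mem_range.2 fun K => ?_)
  calc l ≤ ν (.ofIsOpen isOpen_interior) := hl ⟨_, isOpen_interior, K.2.2, rfl⟩
    _ ≤ ν (.compactSaturation K.2.1) := hν (interior_subset.trans subset_nhdsKer)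

theorem isWeaklyOuterContinuous_iff_isQSmooth_and_isSaturatedMaxitive [QuasiSober E]
    [LocallyCompactSpace E] (hν : Monotone ν) :
    IsWeaklyOuterContinuous ν ↔ IsQSmooth ν ∧ IsSaturatedMaxitive ν :=
  ⟨fun h => ⟨h.isQSmooth hν, h.isSaturatedMaxitive⟩,
    fun h => h.1.isWeaklyOuterContinuous hν h.2⟩

theorem IsQSmooth.exists_hasBorelCoverLE (hν : Monotone ν) (h : IsQSmooth ν)
    (hs : IsSaturatedMaxitive ν) {ι : Type*} {K : ι → Set E} (hK : ∀ i, IsCompact (K i))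
    (hdir : Directed (· ⊇ ·) K) {x : E} (hxK : ∀ i, x ∈ K i) (hKU : ∀ U ∈ 𝓝 x, ∃ i, K i ⊆ U)
    {t : L} (ht : WayAbove t (pointDensity ν x)) : ∃ i, HasBorelCoverLE ν t (K i) := by
  have hglb := h.isGLB_range_compactSaturation hs hK hdir (BorelSet.isCompact_inseparableClass x)
    (fun i y hy => mem_nhdsKer_iff_specializes.2
      ⟨x, hxK i, (BorelSet.mem_inseparableClass.1 hy).specializes⟩)
    fun U hU hxU => hKU U (hU.mem_nhds (hxU (BorelSet.mem_inseparableClass_self x)))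
  have hdirν : DirectedOn (· ≥ ·) (range fun i => ν (.compactSaturation (hK i))) := by
    rintro _ ⟨i, rfl⟩ _ ⟨j, rfl⟩
    obtain ⟨k, hki, hkj⟩ := hdir i j
    exact ⟨_, mem_range_self k, hν (nhdsKer_mono hki), hν (nhdsKer_mono hkj)⟩
  obtain ⟨i, -⟩ := hKU univ univ_mem
  obtain ⟨_, ⟨i, rfl⟩, hi⟩ := ht.exists_le_of_isGLB ⟨_, mem_range_self i⟩ hdirν hglb
  exact ⟨i, _, subset_nhdsKer, hi⟩

theorem IsQSmooth.isUSC_pointDensity [FrechetUrysohnSpace E] (hL : IsContinuousPoset L)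
    (hν : Monotone ν) (h : IsQSmooth ν) (hs : IsSaturatedMaxitive ν) :
    IsUSC (pointDensity ν) := by
  refine fun t => isOpen_iff_mem_nhds.2 fun x hx => ?_
  by_contra hcon
  rw [← mem_interior_iff_mem_nhds, ← notMem_compl_iff, not_not, ← closure_compl,
    mem_closure_iff_seq_limit] at hcon
  obtain ⟨u, hu, hux⟩ := hcon
  obtain ⟨s, hts, hsx⟩ := hL.exists_wayAbove_between hx
  let K : ℕ → Set E := fun m => insert x (range fun n => u (n + m))
  have hK : ∀ m, IsCompact (K m) := fun m =>
    ((tendsto_add_atTop_iff_nat m).2 hux).isCompact_insert_range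
  have hanti : Antitone K := antitone_nat_of_succ_le fun m =>
    insert_subset_insert (range_subset_iff.2 fun n => ⟨n + 1, congrArg u (by omega)⟩)
  have hKU : ∀ U ∈ 𝓝 x, ∃ m, K m ⊆ U := fun U hU => by
    obtain ⟨m, hm⟩ := eventually_atTop.1 (hux.eventually_mem hU)
    exact ⟨m, insert_subset (mem_of_mem_nhds hU) (range_subset_iff.2 fun n => hm _ (by omega))⟩
  obtain ⟨m, hm⟩ := h.exists_hasBorelCoverLE hν hs hK hanti.directed_ge
    (fun _ => mem_insert _ _) hKU hsx
  have hum : u m ∈ K m := .inr ⟨0, congrArg u (zero_add m)⟩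
  exact hu m (hts.mono le_rfl (hm.pointDensity_le hν hum))

variable [OrderBot L]

theorem IsQSmooth.le_of_isCompact [RegularSpace E] (hL : IsContinuousPoset L) (hν : IsMaxitive ν)
    (h : IsQSmooth ν) (hs : IsSaturatedMaxitive ν) {K : BorelSet E} (hK : IsCompact (K : Set E))
    {u : L} (hu : u ∈ upperBounds (pointDensity ν '' K)) : ν K ≤ u := by
  refine hL.le_of_forall_wayAbove fun t ht => hν.le_of_isCompact hK fun x hx => ?_
  let ι := {N : Set E // N ∈ 𝓝 x ∧ IsClosed N}
  have hdir : Directed (· ⊇ ·) fun N : ι => (K : Set E) ∩ N := fun M N =>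
    ⟨⟨M ∩ N, inter_mem M.2.1 N.2.1, M.2.2.inter N.2.2⟩,
      inter_subset_inter_right _ inter_subset_left, inter_subset_inter_right _ inter_subset_right⟩
  have hKU : ∀ U ∈ 𝓝 x, ∃ N : ι, (K : Set E) ∩ N ⊆ U := fun U hU => by
    obtain ⟨N, hN, hNc, hNU⟩ := exists_mem_nhds_isClosed_subset hU
    exact ⟨⟨N, hN, hNc⟩, inter_subset_right.trans hNU⟩
  obtain ⟨N, hN⟩ := h.exists_hasBorelCoverLE hν.monotone hs (fun N : ι => hK.inter_right N.2.2)
    hdir (fun N => ⟨hx, mem_of_mem_nhds N.2.1⟩) hKU (ht.mono le_rfl (hu (mem_image_of_mem _ hx)))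
  exact ⟨_, inter_mem self_mem_nhdsWithin (mem_nhdsWithin_of_mem_nhds N.2.1), hN⟩

theorem IsQSmooth.hasUSCCardinalDensity [RegularSpace E] [FrechetUrysohnSpace E]
    (hE : ∀ G : Set E, IsOpen G → IsSigmaCompact G) (hL : IsContinuousPoset L)
    (h : IsQSmooth ν) (hσ : IsSigmaMaxitive ν) (hs : IsSaturatedMaxitive ν) :
    HasUSCCardinalDensity ν := by
  have hν := hσ.isMaxitive
  have husc := h.isUSC_pointDensity hL hν.monotone hs
  refine ⟨_, husc, isCardinalDensity_pointDensity_of_isUSC hL hν.monotone husc fun G hG u hu =>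
    hσ.le_of_isSigmaCompact hG (hE G hG) fun K hK hKG => ?_⟩
  exact h.le_of_isCompact hL hν hs hK (upperBounds_mono_set (image_mono hKG) hu)

end Smooth

/-! ### Characterizations of regularity -/

section Criteria

variable {E L : Type*} [TopologicalSpace E] [PartialOrder L] [OrderBot L] {ν : BorelSet E → L}

theorem IsRegularMaxitive.isSigmaMaxitive (hL : IsContinuousPoset L) (hν : IsMaxitive ν)
    (h : IsRegularMaxitive ν) : IsSigmaMaxitive ν :=
  have h' : IsOuterContinuous ν ∧ IsCompletelyMaxitive ν :=
    ((hν.isRegularMaxitive_tfae hL).out 0 2).1 h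
  h'.2.isSigmaMaxitive

theorem isWeaklyOuterContinuous_and_isSigmaMaxitive_iff_isRegularMaxitive
    [HereditarilyLindelofSpace E] (hL : IsContinuousPoset L) (hν : IsMaxitive ν) :
    IsWeaklyOuterContinuous ν ∧ IsSigmaMaxitive ν ↔ IsRegularMaxitive ν :=
  ⟨fun h => ((hν.isRegularMaxitive_tfae hL).out 1 0).1 (h.1.hasUSCCardinalDensity hL h.2),
    fun h => ⟨h.2.isWeaklyOuterContinuous, h.isSigmaMaxitive hL hν⟩⟩

variable [QuasiSober E]

theorem isQSmooth_and_isWeaklyInnerContinuous_and_isSaturatedMaxitive_iff_isRegularMaxitive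
    [LocallyCompactSpace E] (hL : IsContinuousPoset L) (hν : IsMaxitive ν) :
    IsQSmooth ν ∧ IsWeaklyInnerContinuous ν ∧ IsSaturatedMaxitive ν ↔ IsRegularMaxitive ν := by
  rw [and_left_comm, ← isWeaklyOuterContinuous_iff_isQSmooth_and_isSaturatedMaxitive hν.monotone,
    and_comm]
  exact (hν.isRegularMaxitive_tfae hL).out 3 0

theorem isQSmooth_and_isSigmaMaxitive_and_isSaturatedMaxitive_iff_isRegularMaxitive
    [RegularSpace E] [FrechetUrysohnSpace E] (hE : ∀ G : Set E, IsOpen G → IsSigmaCompact G)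
    (hL : IsContinuousPoset L) (hν : IsMaxitive ν) :
    IsQSmooth ν ∧ IsSigmaMaxitive ν ∧ IsSaturatedMaxitive ν ↔ IsRegularMaxitive ν := by
  refine ⟨fun h => ((hν.isRegularMaxitive_tfae hL).out 1 0).1
    (h.1.hasUSCCardinalDensity hE hL h.2.1 h.2.2), fun h => ?_⟩
  have ho := h.2.isWeaklyOuterContinuous
  exact ⟨ho.isQSmooth hν.monotone, h.isSigmaMaxitive hL hν, ho.isSaturatedMaxitive⟩

end Criteria

theorem isSigmaCompact_of_isOpen {E : Type*} [TopologicalSpace E] [SigmaCompactSpace E]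
    [TopologicalSpace.PseudoMetrizableSpace E] {G : Set E} (hG : IsOpen G) : IsSigmaCompact G := by
  let := TopologicalSpace.pseudoMetrizableSpacePseudoMetric E
  obtain ⟨F, hF, -, rfl, -⟩ := hG.exists_iUnion_isClosed
  exact isSigmaCompact_iUnion F fun n =>
    isSigmaCompact_univ.of_isClosed_subset (hF n) (subset_univ _)

theorem mainTheorem1_general {E : Type*} [TopologicalSpace E] [QuasiSober E]
    {L : Type*} [PartialOrder L] [OrderBot L] (hL : IsContinuousPoset L)
    (ν : BorelSet E → L) (hν : IsMaxitive ν) :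
    (HasCardinalDensity ν ↔ IsCompletelyMaxitive ν) ∧
    [IsRegularMaxitive ν,
        HasUSCCardinalDensity ν,
        IsOuterContinuous ν ∧ IsCompletelyMaxitive ν,
        IsWeaklyOuterContinuous ν ∧ IsWeaklyInnerContinuous ν].TFAE ∧
    (IsWeaklyOuterContinuous ν ∧ IsWeaklyInnerContinuous ν →
      IsWeaklyOuterContinuous ν ∧ IsSigmaMaxitive ν) ∧
    (IsWeaklyOuterContinuous ν ∧ IsSigmaMaxitive ν →
      IsWeaklyOuterContinuous ν) ∧
    (IsWeaklyOuterContinuous ν →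
      IsQSmooth ν ∧ IsSaturatedMaxitive ν) ∧
    (IsQSmooth ν ∧ IsWeaklyInnerContinuous ν ∧ IsSaturatedMaxitive ν →
      IsQSmooth ν ∧ IsSaturatedMaxitive ν) ∧
    (HereditarilyLindelofSpace E →
      [IsRegularMaxitive ν,
        HasUSCCardinalDensity ν,
        IsOuterContinuous ν ∧ IsCompletelyMaxitive ν,
        IsWeaklyOuterContinuous ν ∧ IsWeaklyInnerContinuous ν,
        IsWeaklyOuterContinuous ν ∧ IsSigmaMaxitive ν].TFAE) ∧
    (LocallyCompactSpace E →
      [IsQSmooth ν ∧ IsWeaklyInnerContinuous ν ∧ IsSaturatedMaxitive ν,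
        IsRegularMaxitive ν,
        HasUSCCardinalDensity ν,
        IsOuterContinuous ν ∧ IsCompletelyMaxitive ν,
        IsWeaklyOuterContinuous ν ∧ IsWeaklyInnerContinuous ν].TFAE ∧
      (IsWeaklyOuterContinuous ν ↔ IsQSmooth ν ∧ IsSaturatedMaxitive ν)) ∧
    ((∀ G : Set E, IsOpen G → IsSigmaCompact G) → RegularSpace E → FrechetUrysohnSpace E →
      [IsQSmooth ν ∧ IsSigmaMaxitive ν ∧ IsSaturatedMaxitive ν,
        IsRegularMaxitive ν,
        HasUSCCardinalDensity ν,
        IsOuterContinuous ν ∧ IsCompletelyMaxitive ν,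
        IsWeaklyOuterContinuous ν ∧ IsWeaklyInnerContinuous ν,
        IsWeaklyOuterContinuous ν ∧ IsSigmaMaxitive ν].TFAE) ∧
    (LocallyCompactSpace E → HereditarilyLindelofSpace E →
      [IsQSmooth ν ∧ IsWeaklyInnerContinuous ν ∧ IsSaturatedMaxitive ν,
        IsQSmooth ν ∧ IsSigmaMaxitive ν ∧ IsSaturatedMaxitive ν,
        IsRegularMaxitive ν,
        HasUSCCardinalDensity ν,
        IsOuterContinuous ν ∧ IsCompletelyMaxitive ν,
        IsWeaklyOuterContinuous ν ∧ IsWeaklyInnerContinuous ν,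
        IsWeaklyOuterContinuous ν ∧ IsSigmaMaxitive ν].TFAE ∧
      (IsWeaklyOuterContinuous ν ↔ IsQSmooth ν ∧ IsSaturatedMaxitive ν)) := by
  have htfae := hν.isRegularMaxitive_tfae hL
  have density : HasUSCCardinalDensity ν ↔ IsRegularMaxitive ν := htfae.out 1 0
  have complete : IsOuterContinuous ν ∧ IsCompletelyMaxitive ν ↔ IsRegularMaxitive ν :=
    htfae.out 2 0
  have outer_inner : IsWeaklyOuterContinuous ν ∧ IsWeaklyInnerContinuous ν ↔
      IsRegularMaxitive ν := htfae.out 3 0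
  have outer_sigma (_ : HereditarilyLindelofSpace E) :=
    isWeaklyOuterContinuous_and_isSigmaMaxitive_iff_isRegularMaxitive hL hν
  have outer (_ : LocallyCompactSpace E) :=
    isWeaklyOuterContinuous_iff_isQSmooth_and_isSaturatedMaxitive hν.monotone
  have smooth_inner (_ : LocallyCompactSpace E) :=
    isQSmooth_and_isWeaklyInnerContinuous_and_isSaturatedMaxitive_iff_isRegularMaxitive hL hν
  refine ⟨hasCardinalDensity_iff_isCompletelyMaxitive, htfae,
    fun h => ⟨h.1, (outer_inner.1 h).isSigmaMaxitive hL hν⟩, And.left,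
    fun h => ⟨h.isQSmooth hν.monotone, h.isSaturatedMaxitive⟩, fun h => ⟨h.1, h.2.2⟩,
    fun hHL => ?_, fun hLC => ⟨?_, outer hLC⟩, fun hσ _ _ => ?_,
    fun hLC hHL => ⟨?_, outer hLC⟩⟩ <;>
  apply List.tfae_of_forall (IsRegularMaxitive ν)
  · simp [density, complete, outer_inner, outer_sigma hHL]
  · simp [density, complete, outer_inner, smooth_inner hLC]
  · have hHL := HereditarilyLindelofSpace.of_forall_isOpen fun G hG => (hσ G hG).isLindelof
    simp [density, complete, outer_inner, outer_sigma hHL,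
      isQSmooth_and_isSigmaMaxitive_and_isSaturatedMaxitive_iff_isRegularMaxitive hσ hL hν]
  · have smooth_sigma : IsQSmooth ν ∧ IsSigmaMaxitive ν ∧ IsSaturatedMaxitive ν ↔
        IsRegularMaxitive ν := by
      rw [and_left_comm, ← outer hLC, and_comm, outer_sigma hHL]
    simp [density, complete, outer_inner, outer_sigma hHL, smooth_inner hLC, smooth_sigma]

theorem mainTheorem1 {E : Type*} [TopologicalSpace E] [QuasiSober E]
    {L : Type*} [PartialOrder L] [OrderBot L] (hL : IsFilteredDomain L)
    (ν : BorelSet E → L) (hν : IsMaxitive ν) :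
    (HasCardinalDensity ν ↔ IsCompletelyMaxitive ν) ∧
    [IsRegularMaxitive ν,
        HasUSCCardinalDensity ν,
        IsOuterContinuous ν ∧ IsCompletelyMaxitive ν,
        IsWeaklyOuterContinuous ν ∧ IsWeaklyInnerContinuous ν].TFAE ∧
    (IsWeaklyOuterContinuous ν ∧ IsWeaklyInnerContinuous ν →
      IsWeaklyOuterContinuous ν ∧ IsSigmaMaxitive ν) ∧
    (IsWeaklyOuterContinuous ν ∧ IsSigmaMaxitive ν →
      IsWeaklyOuterContinuous ν) ∧
    (IsWeaklyOuterContinuous ν →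
      IsQSmooth ν ∧ IsSaturatedMaxitive ν) ∧
    (IsQSmooth ν ∧ IsWeaklyInnerContinuous ν ∧ IsSaturatedMaxitive ν →
      IsQSmooth ν ∧ IsSaturatedMaxitive ν) ∧
    (SecondCountableTopology E →
      [IsRegularMaxitive ν,
        HasUSCCardinalDensity ν,
        IsOuterContinuous ν ∧ IsCompletelyMaxitive ν,
        IsWeaklyOuterContinuous ν ∧ IsWeaklyInnerContinuous ν,
        IsWeaklyOuterContinuous ν ∧ IsSigmaMaxitive ν].TFAE) ∧
    (LocallyCompactSpace E →
      [IsQSmooth ν ∧ IsWeaklyInnerContinuous ν ∧ IsSaturatedMaxitive ν,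
        IsRegularMaxitive ν,
        HasUSCCardinalDensity ν,
        IsOuterContinuous ν ∧ IsCompletelyMaxitive ν,
        IsWeaklyOuterContinuous ν ∧ IsWeaklyInnerContinuous ν].TFAE ∧
      (IsWeaklyOuterContinuous ν ↔ IsQSmooth ν ∧ IsSaturatedMaxitive ν)) ∧
    (SigmaCompactSpace E → TopologicalSpace.MetrizableSpace E →
      [IsQSmooth ν ∧ IsSigmaMaxitive ν ∧ IsSaturatedMaxitive ν,
        IsRegularMaxitive ν,
        HasUSCCardinalDensity ν,
        IsOuterContinuous ν ∧ IsCompletelyMaxitive ν,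
        IsWeaklyOuterContinuous ν ∧ IsWeaklyInnerContinuous ν,
        IsWeaklyOuterContinuous ν ∧ IsSigmaMaxitive ν].TFAE) ∧
    (LocallyCompactSpace E → PolishSpace E →
      [IsQSmooth ν ∧ IsWeaklyInnerContinuous ν ∧ IsSaturatedMaxitive ν,
        IsQSmooth ν ∧ IsSigmaMaxitive ν ∧ IsSaturatedMaxitive ν,
        IsRegularMaxitive ν,
        HasUSCCardinalDensity ν,
        IsOuterContinuous ν ∧ IsCompletelyMaxitive ν,
        IsWeaklyOuterContinuous ν ∧ IsWeaklyInnerContinuous ν,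
        IsWeaklyOuterContinuous ν ∧ IsSigmaMaxitive ν].TFAE ∧
      (IsWeaklyOuterContinuous ν ↔ IsQSmooth ν ∧ IsSaturatedMaxitive ν)) := by
  obtain ⟨density, tfae, outer_sigma, outer, smooth, smooth_inner, lindelof, locallyCompact,
    sigmaCompact, both⟩ := mainTheorem1_general hL.2 ν hν
  exact ⟨density, tfae, outer_sigma, outer, smooth, smooth_inner,
    fun _ => lindelof inferInstance, locallyCompact,
    fun _ _ => sigmaCompact (fun _ => isSigmaCompact_of_isOpen) inferInstance inferInstance,
    fun hLC _ => both hLC inferInstance⟩
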